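/- Let $P,N>0$ be real numbers. For an integer $L\ge 2$ and a finite set $\mathcal L\subset\mathbb R^n$ of $L$ points with centroid $\bar x=\frac1L\sum_{x\in\mathcal L}x$, put $\overline{\mathrm{rad}}^2(\mathcal L)=\frac1L\sum_{x\in\mathcal L}\|x-\bar x\|_2^2$. For a code $\mathcal C\subseteq\mathbb R^n$ let $\overline{\mathrm{rad}}^2_L(\mathcal C)$ be the infimum of $\overline{\mathrm{rad}}^2(\mathcal L)$ over all $L$-element subsets $\mathcal L$ of $\mathcal C$ ($+\infty$ if there are none), and let $R(\mathcal C)=\frac1n\ln|\mathcal C|$. The $(P,N,L-1)$-average-radius multiple packing density is $$\overline C_{L-1}(P,N)=\limsup_{n\to\infty}\ \sup\bigl\{R(\mathcal C):\ \mathcal C\subseteq\mathcal B^n(\sqrt{nP}),\ \overline{\mathrm{rad}}^2_L(\mathcal C)>nN\bigr\},$$ where $\mathcal B^n(r)$ is the closed Euclidean ball of radius $r$ around the origin. Theorem. For every integer $L\ge2$ with $\frac NP\le\frac{L-1}{L}$, $$\overline C_{L-1}(P,N)\ \ge\ \frac12\left[\ln\frac{(L-1)P}{LN}+\frac1{L-1}\ln\frac{P}{L(P-N)}\right],$$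 and the bound is already achieved by spherical codes: the same lower bound holds if in the definition of $\overline C_{L-1}(P,N)$ the supremum is restricted to codes $\mathcal C$ contained in the sphere of radius $\sqrt{nP}$ around the origin. Moreover, if $N<P$, the right-hand side tends to $\frac12\ln\frac PN$ as $L\to\infty$. -/

import Mathlib

noncomputable section

namespace AvgRadPacking

/-- The average squared radius of a finite list `s` of (distinct) points of `ℝⁿ`:
the average squared Euclidean distance of its points to their centroid. -/
def avgSqRadius {n : ℕ} (s : Finset (EuclideanSpace ℝ (Fin n))) : ℝ :=
  (1 / (s.card : ℝ)) * ∑ x ∈ s, ‖x - (1 / (s.card : ℝ)) • ∑ y ∈ s, y‖ ^ 2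

/-- The average squared radius of a code `C` with respect to lists of size `L`: the infimum of
the average squared radii of the `L`-element subsets of `C`. It is `⊤` if `C` has fewer than
`L` points; for finite codes with at least `L` points the infimum is a minimum. -/
def codeAvgSqRadius {n : ℕ} (L : ℕ) (C : Set (EuclideanSpace ℝ (Fin n))) : EReal :=
  ⨅ s ∈ {s : Finset (EuclideanSpace ℝ (Fin n)) | (s : Set (EuclideanSpace ℝ (Fin n))) ⊆ C ∧
    s.card = L}, (avgSqRadius s : EReal)

/-- The rate `(1 / n) ln |C|` of a code `C ⊆ ℝⁿ`, as an extended real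
(`⊥` for the empty code and `⊤` for infinite codes, when `n ≥ 1`). -/
def rate {n : ℕ} (C : Set (EuclideanSpace ℝ (Fin n))) : EReal :=
  ENNReal.log (C.encard : ENNReal) / (n : EReal)

/-- `C` is a `(P, N, L - 1)`-average-radius multiple packing (list-decodable code) in `ℝⁿ`. -/
def IsAvgRadPacking {n : ℕ} (P N : ℝ) (L : ℕ) (C : Set (EuclideanSpace ℝ (Fin n))) : Prop :=
  C ⊆ Metric.closedBall 0 √(n * P) ∧ ((n * N : ℝ) : EReal) < codeAvgSqRadius L C

/-- The `(P, N, L - 1)`-average-radius multiple packing density (list-decoding capacity). -/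
def capacity (P N : ℝ) (L : ℕ) : EReal :=
  Filter.limsup (fun n : ℕ =>
    ⨆ C ∈ {C : Set (EuclideanSpace ℝ (Fin n)) | IsAvgRadPacking P N L C}, rate C) Filter.atTop

/-- The same density with the packings restricted to spherical codes, that is, to subsets of
the sphere of radius `√(nP)` around the origin. -/
def sphericalCapacity (P N : ℝ) (L : ℕ) : EReal :=
  Filter.limsup (fun n : ℕ =>
    ⨆ C ∈ {C : Set (EuclideanSpace ℝ (Fin n)) | C ⊆ Metric.sphere 0 √(n * P) ∧
      IsAvgRadPacking P N L C}, rate C) Filter.atTop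

/-- The value `½ [ln ((L-1)P / (LN)) + (1/(L-1)) ln (P / (L(P-N)))]`. -/
def lowerBound (P N : ℝ) (L : ℕ) : ℝ :=
  1 / 2 * (Real.log (((L : ℝ) - 1) * P / (L * N)) +
    1 / ((L : ℝ) - 1) * Real.log (P / (L * (P - N))))

end AvgRadPacking

end

noncomputable section

namespace AvgRadPacking

open MeasureTheory ProbabilityTheory Filter Topology
open scoped ENNReal

/-! Random coding with expurgation. For points of norm `√(nP)`, an `L`-list has average squared
radius at most `nN` exactly when the squared norm of the sum of its unit directions is at least
`L²(P-N)/P`; call such a list aligned. The directions come from independent Gaussian vectors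
conditioned on a thin shell around the sphere of radius `√n`, which at most doubles the density and
nearly fixes the norms.

`measure_aligned_le` is a Chernoff bound for alignment. The optimal tilt gives the `L` vectors a
covariance with eigenvalue `μ = L(P-N)/P` along the diagonal and `κ = LN/((L-1)P)` on its
complement. Then `μ + (L-1)κ = L`, and the probability is about `(μ κ^(L-1))^(n/2)`, which is
`exp(-n(L-1) * lowerBound)`. Below that rate the expected number of aligned lists is less than half
the number of points (`exists_few_alignedSets`), and deleting one point from each leaves the code
(`exists_packing_of_alignedSets`). -/

/-! ### Gaussian exponential moments and concentration of the norm. -/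

/-- The standard Gaussian measure on `ℝⁿ`, given by its density. -/
def gauss (n : ℕ) : Measure (EuclideanSpace ℝ (Fin n)) :=
  volume.withDensity fun x => ENNReal.ofReal ((√(2 * Real.pi) ^ n)⁻¹ * Real.exp (-‖x‖ ^ 2 / 2))

lemma lintegral_exp_neg_sq_norm (n : ℕ) {κ : ℝ} (hκ : 0 < κ) :
    ∫⁻ y : EuclideanSpace ℝ (Fin n), ENNReal.ofReal (Real.exp (-(1 / (2 * κ)) * ‖y‖ ^ 2)) =
      ENNReal.ofReal (√(2 * Real.pi * κ) ^ n) := by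
  have hπ := Real.pi_pos
  have h := GaussianFourier.integral_rexp_neg_mul_sq_norm (V := EuclideanSpace ℝ (Fin n))
    (b := 1 / (2 * κ)) (by positivity)
  have hne : ∫ y : EuclideanSpace ℝ (Fin n), Real.exp (-(1 / (2 * κ)) * ‖y‖ ^ 2) ≠ 0 := by
    rw [h]; positivity
  have hint := Integrable.of_integral_ne_zero hne
  rw [← ofReal_integral_eq_lintegral_ofReal hint (ae_of_all _ fun _ => (Real.exp_pos _).le), h]
  congr 1
  rw [finrank_euclideanSpace_fin, Real.sqrt_eq_rpow, ← Real.rpow_natCast, ← Real.rpow_mul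
    (by positivity)]
  congr 1 <;> field_simp

/-- The exponential moments of linear and isotropic quadratic forms under the Gaussian measure. -/
lemma lintegral_gauss_exp (n : ℕ) {κ : ℝ} (hκ : 0 < κ) (w : EuclideanSpace ℝ (Fin n)) :
    ∫⁻ y, ENNReal.ofReal (Real.exp (inner ℝ w y + (1 - 1 / κ) / 2 * ‖y‖ ^ 2)) ∂gauss n =
      ENNReal.ofReal (√κ ^ n * Real.exp (κ / 2 * ‖w‖ ^ 2)) := by
  have hπ := Real.pi_pos
  rw [gauss, lintegral_withDensity_eq_lintegral_mul _ (by fun_prop) (by fun_prop)]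
  -- Completing the square: the integrand is a Gaussian of variance `κ` centred at `κ • w`.
  have key : ∀ y : EuclideanSpace ℝ (Fin n),
      ENNReal.ofReal ((√(2 * Real.pi) ^ n)⁻¹ * Real.exp (-‖y‖ ^ 2 / 2)) *
        ENNReal.ofReal (Real.exp (inner ℝ w y + (1 - 1 / κ) / 2 * ‖y‖ ^ 2)) =
      ENNReal.ofReal ((√(2 * Real.pi) ^ n)⁻¹ * Real.exp (κ / 2 * ‖w‖ ^ 2)) *
        ENNReal.ofReal (Real.exp (-(1 / (2 * κ)) * ‖y - κ • w‖ ^ 2)) := by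
    intro y
    rw [← ENNReal.ofReal_mul (by positivity), ← ENNReal.ofReal_mul (by positivity),
      mul_assoc, mul_assoc, ← Real.exp_add, ← Real.exp_add]
    congr 3
    rw [norm_sub_sq_real, inner_smul_right, norm_smul, Real.norm_of_nonneg hκ.le,
      real_inner_comm y w]
    field_simp
    ring
  simp_rw [Pi.mul_apply, key]
  rw [lintegral_const_mul _ (by fun_prop),
    lintegral_sub_right_eq_self (μ := (volume : Measure (EuclideanSpace ℝ (Fin n))))
      (fun y => ENNReal.ofReal (Real.exp (-(1 / (2 * κ)) * ‖y‖ ^ 2))) (κ • w),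
    lintegral_exp_neg_sq_norm n hκ, ← ENNReal.ofReal_mul (by positivity)]
  congr 1
  rw [Real.sqrt_mul (by positivity) κ, mul_pow]
  field_simp

instance (n : ℕ) : IsProbabilityMeasure (gauss n) where
  measure_univ := by
    have h := lintegral_gauss_exp n one_pos 0
    simpa using h

/-- Chernoff bound with tilted variance `s`. The factor `s - 1` lets one set describe the upper tail
for `s > 1` and the lower tail for `s < 1`. -/
lemma gauss_tail_le (n : ℕ) {s : ℝ} (hs : 0 < s) :
    gauss n {x | 0 ≤ (s - 1) * (‖x‖ ^ 2 - n * s)} ≤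
      ENNReal.ofReal (√(s * Real.exp (1 - s)) ^ n) := by
  have h := lintegral_gauss_exp n hs 0
  have hm : MeasurableSet {x : EuclideanSpace ℝ (Fin n) | 0 ≤ (s - 1) * (‖x‖ ^ 2 - n * s)} :=
    measurableSet_le (by fun_prop) (by fun_prop)
  calc gauss n {x | 0 ≤ (s - 1) * (‖x‖ ^ 2 - n * s)}
      = ∫⁻ x in {x | 0 ≤ (s - 1) * (‖x‖ ^ 2 - n * s)}, 1 ∂gauss n := by simp
    _ ≤ ∫⁻ x in {x | 0 ≤ (s - 1) * (‖x‖ ^ 2 - n * s)}, ENNReal.ofReal (Real.exp ((1 - s) / 2 * n))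
        * ENNReal.ofReal (Real.exp (inner ℝ 0 x + (1 - 1 / s) / 2 * ‖x‖ ^ 2)) ∂gauss n := by
        refine setLIntegral_mono' hm fun x hx => ?_
        rw [← ENNReal.ofReal_mul (by positivity), ← Real.exp_add, ← ENNReal.ofReal_one]
        apply ENNReal.ofReal_le_ofReal
        rw [Real.one_le_exp_iff]
        have e : (1 - s) / 2 * n + (inner ℝ 0 x + (1 - 1 / s) / 2 * ‖x‖ ^ 2) =
            ((s - 1) * (‖x‖ ^ 2 - n * s)) / (2 * s) := by
          rw [inner_zero_left]; field_simp; ring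
        rw [e]
        exact div_nonneg hx (by positivity)
    _ ≤ ∫⁻ x, ENNReal.ofReal (Real.exp ((1 - s) / 2 * n))
        * ENNReal.ofReal (Real.exp (inner ℝ 0 x + (1 - 1 / s) / 2 * ‖x‖ ^ 2)) ∂gauss n :=
        setLIntegral_le_lintegral _ _
    _ = _ := by
        rw [lintegral_const_mul _ (by fun_prop), h, ← ENNReal.ofReal_mul (by positivity)]
        congr 1
        rw [Real.sqrt_mul hs.le, mul_pow, ← Real.exp_half, ← Real.exp_nat_mul]
        simp only [norm_zero, ne_eq, OfNat.ofNat_ne_zero, not_false_eq_true, zero_pow, mul_zero,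
          Real.exp_zero, mul_one]
        rw [mul_comm]
        ring_nf

lemma tendsto_gauss_tail {s : ℝ} (hs : 0 < s) (hs1 : s ≠ 1) :
    Tendsto (fun n : ℕ => gauss n {x | 0 ≤ (s - 1) * (‖x‖ ^ 2 - n * s)}) atTop (𝓝 0) := by
  have hlt : √(s * Real.exp (1 - s)) < 1 := by
    have h1 := Real.add_one_lt_exp (x := s - 1) (sub_ne_zero.2 hs1)
    rw [Real.sqrt_lt' one_pos, show 1 - s = -(s - 1) by ring, Real.exp_neg, ← div_eq_mul_inv,
      div_lt_iff₀ (Real.exp_pos _)]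
    linarith
  have h := ENNReal.tendsto_ofReal (tendsto_pow_atTop_nhds_zero_of_lt_one (Real.sqrt_nonneg _) hlt)
  rw [ENNReal.ofReal_zero] at h
  exact tendsto_of_tendsto_of_tendsto_of_le_of_le tendsto_const_nhds h (fun _ => zero_le)
    fun n => gauss_tail_le n hs

/-- The spherical shell of relative width `η` around the sphere of radius `√n`. -/
def shell (n : ℕ) (η : ℝ) : Set (EuclideanSpace ℝ (Fin n)) :=
  {x | (1 - η) * √n ≤ ‖x‖ ∧ ‖x‖ ≤ (1 + η) * √n}

lemma measurableSet_shell (n : ℕ) (η : ℝ) : MeasurableSet (shell n η) :=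
  (measurableSet_le (f := fun _ => (1 - η) * √n) (g := fun x : EuclideanSpace ℝ (Fin n) => ‖x‖)
    (by fun_prop) (by fun_prop)).inter
  (measurableSet_le (g := fun _ => (1 + η) * √n) (f := fun x : EuclideanSpace ℝ (Fin n) => ‖x‖)
    (by fun_prop) (by fun_prop))

lemma eventually_gauss_shell {η : ℝ} (hη : 0 < η) (hη1 : η < 1) :
    ∀ᶠ n : ℕ in atTop, 1 / 2 ≤ gauss n (shell n η) := by
  have h1 := tendsto_gauss_tail (s := (1 - η) ^ 2) (by nlinarith) (by nlinarith)
  have h2 := tendsto_gauss_tail (s := (1 + η) ^ 2) (by nlinarith) (by nlinarith)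
  have h := h1.add h2
  rw [add_zero] at h
  filter_upwards [h.eventually (gt_mem_nhds (show (0 : ℝ≥0∞) < 1 / 2 by simp))] with n hn
  have hc : (shell n η)ᶜ ⊆ {x | 0 ≤ ((1 - η) ^ 2 - 1) * (‖x‖ ^ 2 - n * (1 - η) ^ 2)} ∪
      {x | 0 ≤ ((1 + η) ^ 2 - 1) * (‖x‖ ^ 2 - n * (1 + η) ^ 2)} := by
    intro x hx
    have hn0 := Real.sq_sqrt (Nat.cast_nonneg (α := ℝ) n)
    rcases not_and_or.1 hx with hx | hx
    · left
      rw [Set.mem_ofPred_eq]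
      have : ‖x‖ ^ 2 ≤ ((1 - η) * √n) ^ 2 :=
        pow_le_pow_left₀ (norm_nonneg _) (not_le.1 hx).le 2
      rw [mul_pow, hn0] at this
      exact mul_nonneg_of_nonpos_of_nonpos (by nlinarith) (by linarith)
    · right
      rw [Set.mem_ofPred_eq]
      have : ((1 + η) * √n) ^ 2 ≤ ‖x‖ ^ 2 :=
        pow_le_pow_left₀ (by positivity) (not_le.1 hx).le 2
      rw [mul_pow, hn0] at this
      exact mul_nonneg (by nlinarith) (by linarith)
  have hlt := ((measure_mono hc).trans (measure_union_le _ _)).trans_lt hn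
  have hs := prob_add_prob_compl (μ := gauss n) (measurableSet_shell n η)
  by_contra hcon
  have := ENNReal.add_lt_add (not_le.1 hcon) hlt
  rw [hs, ENNReal.add_halves] at this
  exact lt_irrefl _ this

/-! ### Chernoff bound for aligned directions. -/

lemma lintegral_pi_prod_eq_pow {ι E : Type*} [Fintype ι] [MeasurableSpace E] (ν : Measure E)
    [IsProbabilityMeasure ν] (T : Finset ι) {h : E → ℝ≥0∞} (hh : Measurable h) :
    ∫⁻ x : ι → E, ∏ i ∈ T, h (x i) ∂Measure.pi (fun _ => ν) = (∫⁻ y, h y ∂ν) ^ T.card := by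
  rw [lintegral_prod_eq_prod_lintegral_of_indepFun T (fun i (x : ι → E) => h (x i))
    (iIndepFun_pi fun _ => hh.aemeasurable) (fun i => hh.comp (measurable_pi_apply i)),
    ← Finset.prod_const]
  exact Finset.prod_congr rfl fun i _ =>
    (measurePreserving_eval (fun _ : ι => ν) i).lintegral_comp hh

/-- Exponential moments of quadratic forms in independent nearly Gaussian vectors. -/
lemma lintegral_exp_quadratic_le {ι : Type*} [Fintype ι] {n : ℕ}
    (ν : Measure (EuclideanSpace ℝ (Fin n))) [IsProbabilityMeasure ν]
    (hν : ν ≤ (2 : ℝ≥0∞) • gauss n) (T : Finset ι) {c κ τ : ℝ} (hc : 0 ≤ c) (hκ : 0 < κ)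
    (hτ : 0 < τ) (hrel : 1 - T.card * c * κ = 1 / τ) :
    ∫⁻ x : ι → EuclideanSpace ℝ (Fin n), ENNReal.ofReal (Real.exp (c / 2 * ‖∑ i ∈ T, x i‖ ^ 2 +
      (1 - 1 / κ) / 2 * ∑ i ∈ T, ‖x i‖ ^ 2)) ∂Measure.pi (fun _ => ν) ≤
      ENNReal.ofReal (2 ^ T.card * (√τ * √κ ^ T.card) ^ n) := by
  -- Gaussian linearization: `exp (c/2 * ‖v‖²)` is the mean of `exp ⟨√c z, v⟩` over a standard
  -- Gaussian `z`. For fixed `z` the `x i` decouple, and an isotropic integral in `z` remains, of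
  -- variance `τ`.
  set g : EuclideanSpace ℝ (Fin n) → EuclideanSpace ℝ (Fin n) → ℝ≥0∞ := fun z y =>
    ENNReal.ofReal (Real.exp (inner ℝ (√c • z) y + (1 - 1 / κ) / 2 * ‖y‖ ^ 2)) with hg
  have hgm : ∀ z, Measurable (g z) := fun z => by simp only [hg]; fun_prop
  have hlin : ∀ x : ι → EuclideanSpace ℝ (Fin n),
      ENNReal.ofReal (Real.exp (c / 2 * ‖∑ i ∈ T, x i‖ ^ 2 +
        (1 - 1 / κ) / 2 * ∑ i ∈ T, ‖x i‖ ^ 2)) = ∫⁻ z, ∏ i ∈ T, g z (x i) ∂gauss n := by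
    intro x
    have h := lintegral_gauss_exp n one_pos (√c • ∑ i ∈ T, x i)
    rw [Real.exp_add, ENNReal.ofReal_mul (by positivity)]
    rw [norm_smul, Real.norm_of_nonneg (Real.sqrt_nonneg c), mul_pow, Real.sq_sqrt hc,
      Real.sqrt_one, one_pow, one_mul, ← mul_assoc, show 1 / 2 * c = c / 2 by ring] at h
    rw [← h, ← lintegral_mul_const _ (by fun_prop)]
    refine lintegral_congr fun z => ?_
    rw [← ENNReal.ofReal_mul (by positivity), ← Real.exp_add, hg]
    simp only []
    rw [← ENNReal.ofReal_prod_of_nonneg (fun i _ => (Real.exp_pos _).le), ← Real.exp_sum,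
      Finset.sum_add_distrib, ← Finset.mul_sum, ← inner_sum, real_inner_smul_left,
      real_inner_smul_left, real_inner_comm]
    congr 3
    ring
  have hinner : ∀ z, ∫⁻ y, g z y ∂ν ≤
      ENNReal.ofReal (2 * √κ ^ n * Real.exp (κ * c / 2 * ‖z‖ ^ 2)) := by
    intro z
    refine (lintegral_mono' hν le_rfl).trans ?_
    rw [lintegral_smul_measure, hg]
    simp only []
    rw [lintegral_gauss_exp n hκ, norm_smul, Real.norm_of_nonneg (Real.sqrt_nonneg c), mul_pow,
      Real.sq_sqrt hc, smul_eq_mul, mul_assoc (2 : ℝ), ENNReal.ofReal_mul zero_le_two,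
      ENNReal.ofReal_ofNat, ← mul_assoc (κ / 2), show κ / 2 * c = κ * c / 2 by ring]
  simp_rw [hlin]
  rw [lintegral_lintegral_swap]
  · calc ∫⁻ z, ∫⁻ x : ι → EuclideanSpace ℝ (Fin n), ∏ i ∈ T, g z (x i) ∂Measure.pi (fun _ => ν)
          ∂gauss n
        = ∫⁻ z, (∫⁻ y, g z y ∂ν) ^ T.card ∂gauss n :=
          lintegral_congr fun z => lintegral_pi_prod_eq_pow ν T (hgm z)
      _ ≤ ∫⁻ z, ENNReal.ofReal ((2 * √κ ^ n) ^ T.card) *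
            ENNReal.ofReal (Real.exp (inner ℝ 0 z + (1 - 1 / τ) / 2 * ‖z‖ ^ 2)) ∂gauss n := by
          refine lintegral_mono fun z => (pow_le_pow_left' (hinner z) _).trans (le_of_eq ?_)
          rw [← ENNReal.ofReal_pow (by positivity), ← ENNReal.ofReal_mul (by positivity), mul_pow,
            ← Real.exp_nat_mul, ← hrel, inner_zero_left]
          congr 3
          ring
      _ = _ := by
          rw [lintegral_const_mul _ (by fun_prop), lintegral_gauss_exp n hτ,
            ← ENNReal.ofReal_mul (by positivity)]
          congr 1
          simp only [norm_zero, ne_eq, OfNat.ofNat_ne_zero, not_false_eq_true, zero_pow, mul_zero,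
            Real.exp_zero, mul_one]
          rw [mul_pow, mul_pow, ← pow_mul, ← pow_mul, mul_comm n T.card]
          ring
  · refine Measurable.aemeasurable ?_
    simp only [hg, Function.uncurry_def]
    fun_prop

/-- In the shell each vector is within `η√n` of `√n` times its direction, so alignment of directions
passes to the vectors with error `T.card * η`. Since `b ≤ 0`, the upper bound on the norms is the
relevant one. -/
lemma exponent_le_of_mem_shell {ι : Type*} {n : ℕ} {η c b ρ : ℝ} (T : Finset ι)
    (x : ι → EuclideanSpace ℝ (Fin n)) (hη : 0 ≤ η) (hx : ∀ i ∈ T, x i ∈ shell n η) (hc : 0 ≤ c)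
    (hb : b ≤ 0) (hηρ : T.card * η ≤ √ρ)
    (hbad : ρ ≤ ‖∑ i ∈ T, ‖x i‖⁻¹ • x i‖ ^ 2) :
    n * (c * (√ρ - T.card * η) ^ 2 + b * (T.card * (1 + η) ^ 2)) ≤
      c * ‖∑ i ∈ T, x i‖ ^ 2 + b * ∑ i ∈ T, ‖x i‖ ^ 2 := by
  have hn0 := Real.sq_sqrt (Nat.cast_nonneg (α := ℝ) n)
  have h1 : √ρ ≤ ‖∑ i ∈ T, ‖x i‖⁻¹ • x i‖ := Real.sqrt_le_iff.2 ⟨norm_nonneg _, hbad⟩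
  have h2 : ‖√(n : ℝ) • ∑ i ∈ T, ‖x i‖⁻¹ • x i - ∑ i ∈ T, x i‖ ≤ T.card * (η * √n) := by
    rw [Finset.smul_sum, ← Finset.sum_sub_distrib, ← nsmul_eq_mul]
    refine norm_sum_le_of_le T (fun i hi => ?_) |>.trans (le_of_eq (Finset.sum_const _))
    obtain ⟨h3, h4⟩ := hx i hi
    by_cases h0 : x i = 0
    · simp only [h0, smul_zero, sub_zero, norm_zero]; positivity
    · have hpos := norm_pos_iff.2 h0
      have : √(n : ℝ) • ‖x i‖⁻¹ • x i - x i = (√n * ‖x i‖⁻¹ - 1) • x i := by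
        rw [sub_smul, one_smul, smul_smul]
      rw [this, norm_smul, Real.norm_eq_abs, ← abs_of_pos hpos, ← abs_mul, abs_of_pos hpos, sub_mul,
        inv_mul_cancel_right₀ hpos.ne', abs_le]
      constructor <;> linarith
  have h3 : √n * (√ρ - T.card * η) ≤ ‖∑ i ∈ T, x i‖ := by
    have h4 := norm_sub_norm_le (√(n : ℝ) • ∑ i ∈ T, ‖x i‖⁻¹ • x i) (∑ i ∈ T, x i)
    rw [norm_smul, Real.norm_of_nonneg (Real.sqrt_nonneg _)] at h4
    have h5 := mul_le_mul_of_nonneg_left h1 (Real.sqrt_nonneg (n : ℝ))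
    linarith
  have h4 : n * (√ρ - T.card * η) ^ 2 ≤ ‖∑ i ∈ T, x i‖ ^ 2 := by
    have h6 := pow_le_pow_left₀ (mul_nonneg (Real.sqrt_nonneg _) (sub_nonneg.2 hηρ)) h3 2
    rwa [mul_pow, hn0] at h6
  have h5 : ∑ i ∈ T, ‖x i‖ ^ 2 ≤ T.card * (n * (1 + η) ^ 2) := by
    rw [← nsmul_eq_mul]
    refine Finset.sum_le_card_nsmul _ _ _ fun i hi => ?_
    have := pow_le_pow_left₀ (norm_nonneg _) (hx i hi).2 2
    rw [mul_pow, hn0] at this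
    linarith
  have h6 := mul_le_mul_of_nonneg_left h4 hc
  have h7 := mul_le_mul_of_nonpos_left h5 hb
  linarith

/-- The Gaussian measure conditioned on a shell. -/
def shellGauss (n : ℕ) (η : ℝ) : Measure (EuclideanSpace ℝ (Fin n)) :=
  (gauss n)[|shell n η]

lemma shellGauss_le {n : ℕ} {η : ℝ} (h : 1 / 2 ≤ gauss n (shell n η)) :
    shellGauss n η ≤ (2 : ℝ≥0∞) • gauss n := by
  rw [shellGauss, ProbabilityTheory.cond]
  have h2 : (gauss n (shell n η))⁻¹ ≤ 2 := by
    rw [ENNReal.inv_le_iff_inv_le]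
    simpa using h
  intro s
  simp only [Measure.smul_apply, smul_eq_mul]
  exact mul_le_mul' h2 (Measure.restrict_apply_le _ _)

lemma isProbabilityMeasure_shellGauss {n : ℕ} {η : ℝ} (h : 1 / 2 ≤ gauss n (shell n η)) :
    IsProbabilityMeasure (shellGauss n η) :=
  cond_isProbabilityMeasure (ne_of_gt (lt_of_lt_of_le (by simp) h))

lemma ae_pi_shellGauss {ι : Type*} [Fintype ι] {n : ℕ} {η : ℝ}
    (h : 1 / 2 ≤ gauss n (shell n η)) :
    ∀ᵐ x ∂Measure.pi (fun _ : ι => shellGauss n η), ∀ i, x i ∈ shell n η := by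
  have := isProbabilityMeasure_shellGauss h
  exact eventually_all.2 fun i =>
    Measure.tendsto_eval_ae_ae.eventually (ae_cond_mem (measurableSet_shell n η))

/-- The probability that the directions of independent random vectors are strongly aligned. -/
lemma measure_aligned_le {ι : Type*} [Fintype ι] {n : ℕ} {η : ℝ} (hη : 0 ≤ η)
    (h : 1 / 2 ≤ gauss n (shell n η)) (T : Finset ι) {c κ τ ρ ε : ℝ} (hc : 0 ≤ c) (hκ : 0 < κ)
    (hκ1 : κ ≤ 1) (hτ : 0 < τ) (hrel : 1 - T.card * c * κ = 1 / τ) (hηρ : T.card * η ≤ √ρ)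
    (hε : -2 * ε ≤ c * (√ρ - T.card * η) ^ 2 + (1 - 1 / κ) * (T.card * (1 + η) ^ 2)) :
    Measure.pi (fun _ : ι => shellGauss n η) {x | ρ ≤ ‖∑ i ∈ T, ‖x i‖⁻¹ • x i‖ ^ 2} ≤
      ENNReal.ofReal (Real.exp (n * ε) * (2 ^ T.card * (√τ * √κ ^ T.card) ^ n)) := by
  have := isProbabilityMeasure_shellGauss h
  have hm : MeasurableSet {x : ι → EuclideanSpace ℝ (Fin n) |
      ρ ≤ ‖∑ i ∈ T, ‖x i‖⁻¹ • x i‖ ^ 2} := measurableSet_le (by fun_prop) (by fun_prop)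
  rw [ENNReal.ofReal_mul (Real.exp_pos _).le]
  refine le_trans ?_ (mul_le_mul_right
    (lintegral_exp_quadratic_le (shellGauss n η) (shellGauss_le h) T hc hκ hτ hrel) _)
  rw [← lintegral_const_mul _ (by fun_prop), ← lintegral_indicator_one hm]
  refine lintegral_mono_ae ?_
  filter_upwards [ae_pi_shellGauss h] with x hx
  rw [Set.indicator_apply]
  split_ifs with hbad
  · rw [← ENNReal.ofReal_mul (Real.exp_pos _).le, ← Real.exp_add, Pi.one_apply,
      ← ENNReal.ofReal_one]
    apply ENNReal.ofReal_le_ofReal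
    rw [Real.one_le_exp_iff]
    have hb : 1 - 1 / κ ≤ 0 := sub_nonpos.2 ((one_le_div hκ).2 hκ1)
    have h1 := exponent_le_of_mem_shell T x hη (fun i _ => hx i) hc hb hηρ hbad
    have h2 := mul_le_mul_of_nonneg_left hε (Nat.cast_nonneg (α := ℝ) n)
    linarith
  · exact zero_le

/-! ### From few aligned sets to a spherical packing. -/

lemma avgSqRadius_eq_of_norm_sq_eq {n : ℕ} {s : Finset (EuclideanSpace ℝ (Fin n))} {r : ℝ}
    (hs : s.Nonempty) (hr : ∀ x ∈ s, ‖x‖ ^ 2 = r) :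
    avgSqRadius s = r - ‖∑ x ∈ s, x‖ ^ 2 / (s.card : ℝ) ^ 2 := by
  have hc : (s.card : ℝ) ≠ 0 := by exact_mod_cast hs.card_pos.ne'
  rw [avgSqRadius]
  simp_rw [norm_sub_sq_real]
  rw [Finset.sum_add_distrib, Finset.sum_sub_distrib, ← Finset.mul_sum, ← sum_inner,
    Finset.sum_congr rfl hr, Finset.sum_const, Finset.sum_const, nsmul_eq_mul, nsmul_eq_mul,
    inner_smul_right, real_inner_self_eq_norm_sq, norm_smul, Real.norm_of_nonneg (by positivity)]
  field_simp
  ring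

/-- Deleting one element from each set of a small family leaves a large set containing no member
of the family. -/
lemma exists_large_avoiding {ι : Type*} [Fintype ι] [DecidableEq ι] (F : Finset (Finset ι))
    (hF : ∀ T ∈ F, T.Nonempty) :
    ∃ I : Finset ι, Fintype.card ι ≤ I.card + F.card ∧ ∀ T ∈ F, ¬T ⊆ I := by
  choose f hf using hF
  refine ⟨(F.attach.image fun T => f T.1 T.2)ᶜ, ?_, fun T hT hsub => ?_⟩
  · rw [Finset.card_compl]
    have := Finset.card_image_le (s := F.attach) (f := fun T => f T.1 T.2)
    rw [Finset.card_attach] at this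
    omega
  · exact Finset.mem_compl.1 (hsub (hf T hT))
      (Finset.mem_image_of_mem (fun T => f T.1 T.2) (Finset.mem_attach F ⟨T, hT⟩))

/-- For a finite code the infimum is over finitely many lists, so strictness survives; with no lists
it is `⊤`. -/
lemma lt_codeAvgSqRadius {n L : ℕ} {a : ℝ} (C : Finset (EuclideanSpace ℝ (Fin n)))
    (h : ∀ s ⊆ C, s.card = L → a < avgSqRadius s) :
    (a : EReal) < codeAvgSqRadius L (C : Set (EuclideanSpace ℝ (Fin n))) := by
  have e : codeAvgSqRadius L (C : Set (EuclideanSpace ℝ (Fin n))) =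
      (C.powersetCard L).inf fun s => (avgSqRadius s : EReal) := by
    rw [codeAvgSqRadius, Finset.inf_eq_iInf]
    simp
  rw [e, Finset.lt_inf_iff (EReal.coe_lt_top a)]
  intro s hs
  rw [Finset.mem_powersetCard] at hs
  exact_mod_cast h s hs.1 hs.2

/-- The index sets of size `L` whose directions are strongly aligned. -/
def alignedSets {n M : ℕ} (L : ℕ) (ρ : ℝ) (x : Fin M → EuclideanSpace ℝ (Fin n)) :
    Finset (Finset (Fin M)) :=
  open Classical in
  {T ∈ Finset.univ.powersetCard L | ρ ≤ ‖∑ i ∈ T, ‖x i‖⁻¹ • x i‖ ^ 2}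

lemma mem_alignedSets {n M L : ℕ} {ρ : ℝ} {x : Fin M → EuclideanSpace ℝ (Fin n)}
    {T : Finset (Fin M)} :
    T ∈ alignedSets L ρ x ↔ T.card = L ∧ ρ ≤ ‖∑ i ∈ T, ‖x i‖⁻¹ • x i‖ ^ 2 := by
  classical
  simp [alignedSets]

/-- A family of vectors with few aligned sets of directions contains a large spherical packing. -/
lemma exists_packing_of_alignedSets {n M L : ℕ} {P N : ℝ} (hL : 2 ≤ L) (hP : 0 < P) (hN : 0 < N)
    (hn : 0 < n) (x : Fin M → EuclideanSpace ℝ (Fin n)) (hx : ∀ i, x i ≠ 0)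
    (hbad : 2 * (alignedSets L (L ^ 2 * (P - N) / P) x).card ≤ M) :
    ∃ C : Finset (EuclideanSpace ℝ (Fin n)),
      (C : Set (EuclideanSpace ℝ (Fin n))) ⊆ Metric.sphere 0 √(n * P) ∧
      IsAvgRadPacking P N L (C : Set (EuclideanSpace ℝ (Fin n))) ∧ M ≤ 2 * L * C.card := by
  classical
  have hn' : (0 : ℝ) < n := by exact_mod_cast hn
  have hL' : (0 : ℝ) < L := by positivity
  set X : Fin M → EuclideanSpace ℝ (Fin n) := fun i => √(n * P) • ‖x i‖⁻¹ • x i with hX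
  have hXn : ∀ i, ‖X i‖ = √(n * P) := fun i => by
    rw [hX]
    simp only [norm_smul, norm_inv, norm_norm]
    rw [inv_mul_cancel₀ (norm_ne_zero_iff.2 (hx i)), mul_one,
      Real.norm_of_nonneg (Real.sqrt_nonneg _)]
  have hXs : ∀ T : Finset (Fin M), ‖∑ i ∈ T, X i‖ ^ 2 =
      n * P * ‖∑ i ∈ T, ‖x i‖⁻¹ • x i‖ ^ 2 := fun T => by
    rw [hX]
    simp only []
    rw [← Finset.smul_sum, norm_smul, mul_pow, Real.norm_of_nonneg (Real.sqrt_nonneg _),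
      Real.sq_sqrt (by positivity)]
  obtain ⟨I, hI, hIF⟩ := exists_large_avoiding (alignedSets L (L ^ 2 * (P - N) / P) x)
    (fun T hT => Finset.card_pos.1 (by rw [(mem_alignedSets.1 hT).1]; omega))
  rw [Fintype.card_fin] at hI
  have hgood : ∀ T ⊆ I, T.card = L → ‖∑ i ∈ T, X i‖ ^ 2 < L ^ 2 * (n * (P - N)) := by
    intro T hT hTL
    have h1 : ‖∑ i ∈ T, ‖x i‖⁻¹ • x i‖ ^ 2 < L ^ 2 * (P - N) / P :=
      not_le.1 fun h => hIF T (mem_alignedSets.2 ⟨hTL, h⟩) hT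
    rw [hXs]
    calc n * P * ‖∑ i ∈ T, ‖x i‖⁻¹ • x i‖ ^ 2 < n * P * (L ^ 2 * (P - N) / P) :=
          mul_lt_mul_of_pos_left h1 (by positivity)
      _ = _ := by field_simp
  have hsphere : ((I.image X : Finset _) : Set (EuclideanSpace ℝ (Fin n))) ⊆
      Metric.sphere 0 √(n * P) := by
    intro y hy
    obtain ⟨i, -, rfl⟩ := Finset.mem_image.1 (Finset.mem_coe.1 hy)
    rw [mem_sphere_zero_iff_norm, hXn]
  refine ⟨I.image X, hsphere, ⟨hsphere.trans Metric.sphere_subset_closedBall, ?_⟩, ?_⟩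
  · refine lt_codeAvgSqRadius _ fun s hs hsL => ?_
    obtain ⟨T, hTI, hinj, rfl⟩ := Finset.exists_subset_injOn_image_eq_of_surjOn (f := X) (I : Set _)
      s (by
        intro y hy
        obtain ⟨i, hi, rfl⟩ := Finset.mem_image.1 (hs (Finset.mem_coe.1 hy))
        exact ⟨i, hi, rfl⟩)
    have hTL : T.card = L := by rw [← hsL, Finset.card_image_of_injOn hinj]
    rw [avgSqRadius_eq_of_norm_sq_eq (r := n * P) (Finset.card_pos.1 (by rw [hsL]; omega)) ?_,
      hsL, Finset.sum_image hinj]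
    · have h1 : ‖∑ i ∈ T, X i‖ ^ 2 / (L : ℝ) ^ 2 < n * (P - N) := by
        rw [div_lt_iff₀ (by positivity)]
        linarith [hgood T (by exact_mod_cast hTI) hTL]
      linarith
    · intro y hy
      obtain ⟨i, -, rfl⟩ := Finset.mem_image.1 hy
      rw [hXn, Real.sq_sqrt (by positivity)]
  -- `X` need not be injective, but `L` coinciding points would form an aligned set, their sum
  -- having squared norm `L² * n * P`.
  · have hfib : I.card ≤ L * (I.image X).card := by
      refine Finset.card_le_mul_card_image I L fun y hy => ?_
      by_contra! hlt
      obtain ⟨T, hT, hTL⟩ := Finset.exists_subset_card_eq hlt.le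
      have h1 := hgood T (hT.trans (Finset.filter_subset _ _)) hTL
      have h2 : ∑ i ∈ T, X i = (L : ℝ) • y := by
        rw [Finset.sum_congr rfl fun i hi => (Finset.mem_filter.1 (hT hi)).2, Finset.sum_const,
          hTL, Nat.cast_smul_eq_nsmul]
      obtain ⟨i, -, rfl⟩ := Finset.mem_image.1 hy
      rw [h2, norm_smul, mul_pow, hXn, Real.sq_sqrt (by positivity),
        Real.norm_of_nonneg (by positivity)] at h1
      have := lt_of_mul_lt_mul_left h1 (by positivity)
      nlinarith
    nlinarith

/-! ### First moment argument and choice of parameters. -/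

/-- First moment method: some sample in the shell has no more aligned sets than expected. -/
lemma exists_few_alignedSets {n L : ℕ} (M : ℕ) {η ρ p : ℝ} (hp : 0 ≤ p)
    (h : 1 / 2 ≤ gauss n (shell n η))
    (hprob : ∀ T : Finset (Fin M), T.card = L → Measure.pi (fun _ : Fin M => shellGauss n η)
      {x | ρ ≤ ‖∑ i ∈ T, ‖x i‖⁻¹ • x i‖ ^ 2} ≤ ENNReal.ofReal p) :
    ∃ x : Fin M → EuclideanSpace ℝ (Fin n), (∀ i, x i ∈ shell n η) ∧
      ((alignedSets L ρ x).card : ℝ) ≤ M ^ L * p := by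
  classical
  have := isProbabilityMeasure_shellGauss h
  let B : Finset (Fin M) → Set (Fin M → EuclideanSpace ℝ (Fin n)) := fun T =>
    {x | ρ ≤ ‖∑ i ∈ T, ‖x i‖⁻¹ • x i‖ ^ 2}
  have hB : ∀ T, MeasurableSet (B T) := fun T => measurableSet_le (by fun_prop) (by fun_prop)
  obtain ⟨x, hx, hle⟩ := exists_notMem_null_le_lintegral
    (μ := Measure.pi (fun _ : Fin M => shellGauss n η))
    (f := fun x => ∑ T ∈ Finset.univ.powersetCard L, (B T).indicator 1 x)
    (Finset.measurable_fun_sum _ fun T _ => measurable_one.indicator (hB T)).aemeasurable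
    (ae_iff.1 (ae_pi_shellGauss h))
  refine ⟨x, by simpa using hx, ?_⟩
  rw [lintegral_finsetSum _ fun T _ => measurable_one.indicator (hB T)] at hle
  have h1 : ((alignedSets L ρ x).card : ℝ≥0∞) =
      ∑ T ∈ Finset.univ.powersetCard L, (B T).indicator 1 x := by
    rw [alignedSets, Finset.card_filter, Nat.cast_sum]
    refine Finset.sum_congr rfl fun T _ => ?_
    simp [Set.indicator_apply, B]
  have h2 : ∑ T ∈ Finset.univ.powersetCard L,
      ∫⁻ x, (B T).indicator 1 x ∂Measure.pi (fun _ : Fin M => shellGauss n η) ≤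
      ENNReal.ofReal (M ^ L * p) := by
    calc _ ≤ ∑ T ∈ (Finset.univ : Finset (Fin M)).powersetCard L, ENNReal.ofReal p := by
          refine Finset.sum_le_sum fun T hT => ?_
          rw [lintegral_indicator_one (hB T)]
          exact hprob T (Finset.mem_powersetCard.1 hT).2
      _ ≤ _ := by
          rw [Finset.sum_const, Finset.card_powersetCard, Finset.card_univ, Fintype.card_fin,
            nsmul_eq_mul, ENNReal.ofReal_mul (by positivity), ← Nat.cast_pow,
            ENNReal.ofReal_natCast]
          gcongr
          exact Nat.choose_le_pow _ _
  rw [← h1] at hle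
  have h3 := hle.trans h2
  rw [← ENNReal.ofReal_natCast] at h3
  exact (ENNReal.ofReal_le_ofReal_iff (by positivity)).1 h3

/-- At `η = 0` the exponent vanishes by the trace identity `hsum`; continuity gives a small positive
`η`. -/
lemma exists_shell_width {L κ μ ε : ℝ} (hL : 0 < L) (hκ : 0 < κ) (hμ : 0 < μ)
    (hsum : μ + (L - 1) * κ = L) (hε : 0 < ε) :
    ∃ η : ℝ, 0 < η ∧ η < 1 ∧ L * η ≤ √(L * μ) ∧
      -2 * ε ≤ (1 / κ - 1 / μ) / L * (√(L * μ) - L * η) ^ 2 +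
        (1 - 1 / κ) * (L * (1 + η) ^ 2) := by
  have hsq : 0 < √(L * μ) := Real.sqrt_pos.2 (by positivity)
  have hc1 : Continuous fun η : ℝ => √(L * μ) - L * η := by fun_prop
  have hc2 : Continuous fun η : ℝ => (1 / κ - 1 / μ) / L * (√(L * μ) - L * η) ^ 2 +
        (1 - 1 / κ) * (L * (1 + η) ^ 2) := by fun_prop
  have h0 : (1 / κ - 1 / μ) / L * (√(L * μ) - L * 0) ^ 2 + (1 - 1 / κ) * (L * (1 + 0) ^ 2) = 0 := by
    rw [mul_zero, sub_zero, Real.sq_sqrt (by positivity)]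
    field_simp
    linear_combination hsum
  have e1 : ∀ᶠ η in 𝓝[>] (0 : ℝ), 0 < √(L * μ) - L * η :=
    (hc1.tendsto 0).mono_left nhdsWithin_le_nhds |>.eventually
      (lt_mem_nhds (by rw [mul_zero, sub_zero]; exact hsq))
  have e2 := (hc2.tendsto 0).mono_left (nhdsWithin_le_nhds (s := Set.Ioi 0)) |>.eventually
      (lt_mem_nhds (a := -2 * ε) (by rw [h0]; linarith))
  have e3 : ∀ᶠ η in 𝓝[>] (0 : ℝ), η ∈ Set.Ioo (0 : ℝ) 1 := Ioo_mem_nhdsGT one_pos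
  obtain ⟨η, h1, h2, h3⟩ := (e1.and (e2.and e3)).exists
  exact ⟨η, h3.1, h3.2, by linarith, h2.le⟩

/-- Spherical packings of every rate below the bound exist in all large dimensions. -/
lemma eventually_exists_packing {P N : ℝ} (hP : 0 < P) (hN : 0 < N) {L : ℕ} (hL : 2 ≤ L)
    (hNP : N / P ≤ ((L : ℝ) - 1) / L) {R : ℝ} (hR0 : 0 ≤ R) (hR : R < lowerBound P N L) :
    ∀ᶠ n : ℕ in atTop, ∃ C : Finset (EuclideanSpace ℝ (Fin n)),
      (C : Set (EuclideanSpace ℝ (Fin n))) ⊆ Metric.sphere 0 √(n * P) ∧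
      IsAvgRadPacking P N L (C : Set (EuclideanSpace ℝ (Fin n))) ∧ Real.exp (n * R) ≤ C.card := by
  have hL2 : (2 : ℝ) ≤ L := by exact_mod_cast hL
  have hL0 : (0 : ℝ) < L := by linarith
  have hL1 : (0 : ℝ) < L - 1 := by linarith
  rw [div_le_div_iff₀ hP hL0] at hNP
  have hPN : 0 < P - N := by nlinarith
  set κ : ℝ := L * N / ((L - 1) * P) with hκd
  set μ : ℝ := L * (P - N) / P with hμd
  have hκ : 0 < κ := by positivity
  have hμ : 0 < μ := by positivity
  -- The hypothesis on `N / P` says `κ ≤ 1`, hence `1 ≤ μ`; this gives the tilt the signs the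
  -- Chernoff bound needs.
  have hκ1 : κ ≤ 1 := by rw [hκd, div_le_one (by positivity)]; linarith
  have hsum : μ + (L - 1) * κ = L := by rw [hκd, hμd]; field_simp; ring
  have hμ1 : 1 ≤ μ := by nlinarith
  -- Half of the exponent gap: the other half still beats the constants depending on `L`.
  set ε : ℝ := (L - 1) * (lowerBound P N L - R) / 2 with hεd
  have hε : 0 < ε := by
    have := sub_pos.2 hR
    positivity
  obtain ⟨η, hη, hη1, hηρ, hηε⟩ := exists_shell_width hL0 hκ hμ hsum hε
  have hc : 0 ≤ (1 / κ - 1 / μ) / (L : ℝ) := by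
    refine div_nonneg (sub_nonneg.2 ?_) hL0.le
    exact one_div_le_one_div_of_le hκ (hκ1.trans hμ1)
  have hrel : 1 - L * ((1 / κ - 1 / μ) / L) * κ = 1 / (μ / κ) := by field_simp; ring
  have hbase : √(μ / κ) * √κ ^ L = Real.exp (-((L - 1) * lowerBound P N L)) := by
    have hlb : lowerBound P N L = 1 / 2 * (-Real.log κ + 1 / ((L : ℝ) - 1) * -Real.log μ) := by
      rw [lowerBound, ← Real.log_inv, ← Real.log_inv, hκd, hμd, inv_div, inv_div]
    rw [← Real.exp_log (show 0 < √(μ / κ) * √κ ^ L by positivity),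
      Real.log_mul (by positivity) (by positivity), Real.log_pow, Real.log_sqrt (by positivity),
      Real.log_sqrt (by positivity), Real.log_div hμ.ne' hκ.ne', hlb]
    congr 1
    field_simp
    ring
  have hρ : (L : ℝ) ^ 2 * (P - N) / P = L * μ := by rw [hμd]; ring
  have hLcast : ((L - 1 : ℕ) : ℝ) = L - 1 := by rw [Nat.cast_sub (by omega)]; simp
  have hlim : Tendsto (fun n : ℕ => 2 * (3 * (L : ℝ)) ^ (L - 1) * 2 ^ L * Real.exp (-(n * ε)))
      atTop (𝓝 0) := by
    have h1 : Tendsto (fun n : ℕ => Real.exp (-(n * ε))) atTop (𝓝 0) :=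
      Real.tendsto_exp_neg_atTop_nhds_zero.comp
        (tendsto_natCast_atTop_atTop.atTop_mul_const hε)
    simpa using h1.const_mul (2 * (3 * (L : ℝ)) ^ (L - 1) * 2 ^ L)
  filter_upwards [eventually_gauss_shell hη hη1, hlim.eventually (gt_mem_nhds one_pos),
    eventually_gt_atTop 0] with n hshell hsmall hn
  -- The factor `2` pays for the deleted points, the factor `L` for possible coincidences.
  set M : ℕ := ⌈2 * L * Real.exp (n * R)⌉₊ with hMd
  have hexp1 : 1 ≤ Real.exp (n * R) := Real.one_le_exp (by positivity)
  have hM1 : 2 * L * Real.exp (n * R) ≤ M := Nat.le_ceil _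
  have hM2 : (M : ℝ) ≤ 3 * L * Real.exp (n * R) := by
    have := Nat.ceil_lt_add_one (show 0 ≤ 2 * L * Real.exp (n * R) by positivity)
    nlinarith
  set p : ℝ := Real.exp (n * ε) * (2 ^ L * (√(μ / κ) * √κ ^ L) ^ n) with hpd
  have hp0 : 0 ≤ p := by positivity
  have hp : p = 2 ^ L * (Real.exp (-(n * ε)) * (Real.exp (n * R) ^ (L - 1))⁻¹) := by
    rw [hpd, hbase, ← Real.exp_nat_mul, ← Real.exp_nat_mul, ← Real.exp_neg, ← Real.exp_add,
      mul_left_comm, ← Real.exp_add, hLcast]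
    congr 2
    rw [hεd]
    ring
  have hMp : 2 * ((M : ℝ) ^ L * p) ≤ M := by
    have h1 : (M : ℝ) ^ (L - 1) ≤ (3 * L) ^ (L - 1) * Real.exp (n * R) ^ (L - 1) := by
      rw [← mul_pow]; exact pow_le_pow_left₀ (by positivity) hM2 _
    have h2 : 2 * ((M : ℝ) ^ (L - 1) * p) ≤ 1 := by
      refine le_trans ?_ hsmall.le
      calc 2 * ((M : ℝ) ^ (L - 1) * p)
          ≤ 2 * ((3 * L) ^ (L - 1) * Real.exp (n * R) ^ (L - 1) * p) := by gcongr
        _ = _ := by rw [hp]; field_simp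
    calc 2 * ((M : ℝ) ^ L * p) = 2 * ((M : ℝ) ^ (L - 1) * p) * M := by
          rw [← Nat.sub_add_cancel (show 1 ≤ L by omega), pow_succ, Nat.add_sub_cancel]; ring
      _ ≤ 1 * M := by gcongr
      _ = M := one_mul _
  obtain ⟨x, hx, hcard⟩ := exists_few_alignedSets (L := L) (ρ := L * μ) M hp0 hshell
    (fun T hT => by
      simpa only [hT] using measure_aligned_le (τ := μ / κ) (ε := ε) hη.le hshell T hc hκ hκ1
        (by positivity) (by rw [hT]; exact hrel) (by rw [hT]; exact hηρ) (by rw [hT]; exact hηε))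
  have hn' : (0 : ℝ) < √n := Real.sqrt_pos.2 (by exact_mod_cast hn)
  obtain ⟨C, hC1, hC2, hC3⟩ := exists_packing_of_alignedSets hL hP hN hn x
    (fun i => norm_pos_iff.1 (lt_of_lt_of_le (mul_pos (by linarith) hn') (hx i).1))
    (by
      rw [hρ]
      have : 2 * ((alignedSets L (L * μ) x).card : ℝ) ≤ M := by linarith
      exact_mod_cast this)
  refine ⟨C, hC1, hC2, ?_⟩
  have hC3' : (M : ℝ) ≤ 2 * L * C.card := by exact_mod_cast hC3
  exact le_of_mul_le_mul_left (hM1.trans hC3') (by positivity)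

/-! ### From packings to capacities. -/

lemma exists_singleton_packing (P N : ℝ) {L n : ℕ} (hL : 2 ≤ L) (hn : 0 < n) :
    ∃ C : Finset (EuclideanSpace ℝ (Fin n)),
      (C : Set (EuclideanSpace ℝ (Fin n))) ⊆ Metric.sphere 0 √(n * P) ∧
      IsAvgRadPacking P N L (C : Set (EuclideanSpace ℝ (Fin n))) ∧ C.card = 1 := by
  have hs : (({EuclideanSpace.single ⟨0, hn⟩ √(n * P)} : Finset (EuclideanSpace ℝ (Fin n))) :
      Set (EuclideanSpace ℝ (Fin n))) ⊆ Metric.sphere 0 √(n * P) := by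
    simp [abs_of_nonneg (Real.sqrt_nonneg _)]
  refine ⟨{EuclideanSpace.single ⟨0, hn⟩ √(n * P)}, hs,
    ⟨hs.trans Metric.sphere_subset_closedBall, lt_codeAvgSqRadius _ fun s hs hsL => ?_⟩,
    Finset.card_singleton _⟩
  have := Finset.card_le_card hs
  rw [Finset.card_singleton] at this
  omega

lemma le_rate {n : ℕ} (hn : 0 < n) {R : ℝ} (C : Finset (EuclideanSpace ℝ (Fin n)))
    (h : Real.exp (n * R) ≤ C.card) : (R : EReal) ≤ rate (C : Set (EuclideanSpace ℝ (Fin n))) := by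
  rw [rate, EReal.le_div_iff_mul_le (by exact_mod_cast hn) (EReal.natCast_ne_top n),
    Set.encard_coe_eq_coe_finsetCard]
  have h1 : ENNReal.log (ENNReal.ofReal (Real.exp (n * R))) ≤ ENNReal.log (C.card : ℝ≥0∞) := by
    refine ENNReal.log_monotone ?_
    rw [← ENNReal.ofReal_natCast]
    exact ENNReal.ofReal_le_ofReal h
  rw [ENNReal.log_ofReal_of_pos (Real.exp_pos _), Real.log_exp] at h1
  refine le_trans (le_of_eq ?_) h1
  push_cast
  rw [mul_comm]

lemma lowerBound_le_sphericalCapacity {P N : ℝ} (hP : 0 < P) (hN : 0 < N) {L : ℕ} (hL : 2 ≤ L)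
    (hNP : N / P ≤ ((L : ℝ) - 1) / L) :
    (lowerBound P N L : EReal) ≤ sphericalCapacity P N L := by
  refine EReal.ge_of_forall_gt_iff_ge.1 fun R hR => ?_
  have hev : ∀ᶠ n : ℕ in atTop, ∃ C : Finset (EuclideanSpace ℝ (Fin n)),
      (C : Set (EuclideanSpace ℝ (Fin n))) ⊆ Metric.sphere 0 √(n * P) ∧
      IsAvgRadPacking P N L (C : Set (EuclideanSpace ℝ (Fin n))) ∧ Real.exp (n * R) ≤ C.card := by
    -- Negative target rates are met by a single point, which contains no `L`-list.
    rcases le_or_gt 0 R with h0 | h0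
    · exact eventually_exists_packing hP hN hL hNP h0 (by exact_mod_cast hR)
    · filter_upwards [eventually_gt_atTop 0] with n hn
      obtain ⟨C, h1, h2, h3⟩ := exists_singleton_packing P N hL hn
      refine ⟨C, h1, h2, ?_⟩
      rw [h3, Nat.cast_one, Real.exp_le_one_iff]
      exact mul_nonpos_of_nonneg_of_nonpos (Nat.cast_nonneg _) h0.le
  refine le_limsup_of_frequently_le (Eventually.frequently ?_) (by isBoundedDefault)
  filter_upwards [hev, eventually_gt_atTop 0] with n hC hn
  obtain ⟨C, h1, h2, h3⟩ := hC
  have hmem : (C : Set (EuclideanSpace ℝ (Fin n))) ∈ {C : Set (EuclideanSpace ℝ (Fin n)) |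
      C ⊆ Metric.sphere 0 √(n * P) ∧ IsAvgRadPacking P N L C} := ⟨h1, h2⟩
  exact (le_rate hn C h3).trans (le_iSup₂_of_le (C : Set (EuclideanSpace ℝ (Fin n))) hmem le_rfl)

lemma sphericalCapacity_le_capacity (P N : ℝ) (L : ℕ) :
    sphericalCapacity P N L ≤ capacity P N L :=
  limsup_le_limsup (Eventually.of_forall fun _ => biSup_mono fun _ hC => hC.2)

/-! ### The limit of large list size. -/

lemma tendsto_lowerBound {P N : ℝ} (hP : 0 < P) (hN : 0 < N) (hNP : N < P) :
    Tendsto (fun L : ℕ => lowerBound P N L) atTop (𝓝 (1 / 2 * Real.log (P / N))) := by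
  have hPN := sub_pos.2 hNP
  have hL : Tendsto (fun L : ℕ => (L : ℝ)) atTop atTop := tendsto_natCast_atTop_atTop
  have h1 : Tendsto (fun L : ℕ => Real.log (((L : ℝ) - 1) * P / (L * N))) atTop
      (𝓝 (Real.log (P / N))) := by
    have h2 : Tendsto (fun L : ℕ => (1 - (L : ℝ)⁻¹) * (P / N)) atTop (𝓝 (P / N)) := by
      simpa using ((tendsto_inv_atTop_zero.comp hL).const_sub 1).mul_const (P / N)
    refine (h2.log (by positivity)).congr' ?_
    filter_upwards [eventually_gt_atTop 0] with L h0
    have : (L : ℝ) ≠ 0 := by positivity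
    congr 1
    field_simp
  have h3 : Tendsto (fun L : ℕ => 1 / ((L : ℝ) - 1) * Real.log (P / (L * (P - N)))) atTop
      (𝓝 0) := by
    -- The exponent `1` and the form `1 * x + -1` match `Real.tendsto_pow_log_div_mul_add_atTop`.
    have h4 : Tendsto (fun x : ℝ => Real.log (P / (P - N)) * (1 / (x - 1)) -
        Real.log x ^ 1 / (1 * x + -1)) atTop (𝓝 (Real.log (P / (P - N)) * 0 - 0)) := by
      refine Tendsto.sub (Tendsto.const_mul _ ?_)
        (Real.tendsto_pow_log_div_mul_add_atTop 1 (-1) 1 one_ne_zero)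
      simp_rw [one_div]
      exact tendsto_inv_atTop_zero.comp (tendsto_atTop_add_const_right _ (-1) tendsto_id)
    rw [mul_zero, sub_zero] at h4
    refine (h4.comp hL).congr' ?_
    filter_upwards [eventually_gt_atTop 0] with L h0
    have hL0 : (L : ℝ) ≠ 0 := by positivity
    rw [Function.comp_apply, mul_comm (L : ℝ), ← div_div, Real.log_div (by positivity) hL0]
    ring
  have h5 := (h1.add h3).const_mul (1 / 2)
  rwa [add_zero] at h5

end AvgRadPacking

end

theorem mainTheorem1 (P N : ℝ) (hP : 0 < P) (hN : 0 < N) :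
    (∀ L : ℕ, 2 ≤ L → N / P ≤ ((L : ℝ) - 1) / L →
      (AvgRadPacking.lowerBound P N L : EReal) ≤ AvgRadPacking.capacity P N L ∧
      (AvgRadPacking.lowerBound P N L : EReal) ≤ AvgRadPacking.sphericalCapacity P N L) ∧
    (N < P → Filter.Tendsto (fun L : ℕ => AvgRadPacking.lowerBound P N L) Filter.atTop
      (nhds (1 / 2 * Real.log (P / N)))) := by
  refine ⟨fun L hL hNP => ?_, fun hNP => AvgRadPacking.tendsto_lowerBound hP hN hNP⟩
  have h := AvgRadPacking.lowerBound_le_sphericalCapacity hP hN hL hNP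
  exact ⟨h.trans (AvgRadPacking.sphericalCapacity_le_capacity P N L), h⟩
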